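/- Setting. Let $A\in\mathbb{R}^{n\times n}$, $C\in\mathbb{R}^{m\times n}$, let $\Sigma_w$ be positive semidefinite and $\Sigma_v$ positive definite, with $(A,C)$ detectable and $(A,\sqrt{\Sigma_w})$ stabilizable, and let $\overline P$ be the steady-state filtering error covariance of the Kalman filter for $x(k+1)=Ax(k)+w(k)$, $y(k)=Cx(k)+v(k)$ with noise covariances $\Sigma_w,\Sigma_v$; that is, $\overline P$ is positive semidefinite and $\overline P=M-MC^\top(CMC^\top+\Sigma_v)^{-1}CM$ with $M=A\overline PA^\top+\Sigma_w$. At each time $k\ge 0$ the sensor decides $a(k)\in\{0,1\}$. If $a(k)=1$, then the packet is received, $\eta(k+1)=1$, with probability $r_s\in(0,1]$ and lost, $\eta(k+1)=0$, otherwise, independently of the past; if $a(k)=0$, then $\eta(k+1)=0$. Start from $\eta(0)=1$ and let $\tau(k)=\min\{0\le t\le k:\eta(k-t)=1\}$. The error covariance of the remote estimator is $P(0)=\overline P$ and, for $k\ge0$, $P(k+1)=\overline P$ if $\eta(k+1)=1$ and $P(k+1)=AP(k)A^\top+\Sigma_w$ if $\eta(k+1)=0$. An admissible policy $f=\{f_k\}$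 chooses $a(k)$, possibly at random, as a function of $\tau(0),\dots,\tau(k),a(0),\dots,a(k-1)$. Put $$J_e(f)=\limsup_{T\to\infty}\frac1T\,\mathbb{E}^f\Big[\sum_{k=0}^{T-1}\mathrm{Tr}\,P(k)\Big]\in[0,\infty],\qquad J_r(f)=\limsup_{T\to\infty}\frac1T\,\mathbb{E}^f\Big[\sum_{k=0}^{T-1}a(k)\Big].$$ Theorem. Let $0<b\le 1$. The constrained communication problem of minimizing $J_e(f)$ over all admissible policies $f$ with $J_r(f)\le b$ is solved by a Bernoulli randomized threshold policy: there are $\theta^\star\in\mathbb{N}$ and $r_{\theta^\star}\in[0,1]$ such that the policy $f^\star$ which does not transmit when $\tau(k)<\theta^\star$, transmits with probability $r_{\theta^\star}$ when $\tau(k)=\theta^\star$, and transmits when $\tau(k)>\theta^\star$, has $J_r(f^\star)=b$ and satisfies $J_e(f^\star)\le J_e(f)$ for every admissible $f$ with $J_r(f)\le b$. Moreover, every such threshold policy, with parameters $\theta\in\mathbb{N}$ and $r\in[0,1]$, whose average transmission rate $J_r$ equals $b$ is optimal in this sense. -/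

import Mathlib

open Matrix Filter
open scoped MatrixOrder

namespace RemoteEstimation

/-! ### The plant and the steady state of the sensor's Kalman filter -/

/-- A real square matrix is Schur stable: all its complex eigenvalues lie in the open unit disc. -/
def SchurStable {n : ℕ} (M : Matrix (Fin n) (Fin n) ℝ) : Prop :=
  ∀ z ∈ spectrum ℂ (M.map (algebraMap ℝ ℂ)), ‖z‖ < 1

/-- The pair `(A, C)` is detectable: some output injection stabilizes it. -/
def Detectable {n m : ℕ} (A : Matrix (Fin n) (Fin n) ℝ) (C : Matrix (Fin m) (Fin n) ℝ) : Prop :=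
  ∃ L : Matrix (Fin n) (Fin m) ℝ, SchurStable (A - L * C)

/-- The pair `(A, B)` is stabilizable: some state feedback stabilizes it. -/
def Stabilizable {n p : ℕ} (A : Matrix (Fin n) (Fin n) ℝ) (B : Matrix (Fin n) (Fin p) ℝ) : Prop :=
  ∃ K : Matrix (Fin p) (Fin n) ℝ, SchurStable (A - B * K)

/-- Covariance prediction over one time step without data: `P ↦ A P Aᵀ + Σ_w`. -/
def predictCov {n : ℕ} (A Sw P : Matrix (Fin n) (Fin n) ℝ) : Matrix (Fin n) (Fin n) ℝ :=
  A * P * Aᵀ + Sw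

/-- The measurement update of a predicted error covariance `M` in the Kalman filter:
`M ↦ M - M Cᵀ (C M Cᵀ + Σ_v)⁻¹ C M`. -/
noncomputable def measurementUpdate {n m : ℕ} (C : Matrix (Fin m) (Fin n) ℝ)
    (Sv : Matrix (Fin m) (Fin m) ℝ) (M : Matrix (Fin n) (Fin n) ℝ) : Matrix (Fin n) (Fin n) ℝ :=
  M - M * Cᵀ * (C * M * Cᵀ + Sv)⁻¹ * C * M

/-- `Pbar` is a steady state of the (filtered) error covariance of the Kalman filter: a positive
semidefinite matrix reproduced by one prediction followed by one measurement update. -/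
def IsKalmanSteadyState {n m : ℕ} (A : Matrix (Fin n) (Fin n) ℝ) (C : Matrix (Fin m) (Fin n) ℝ)
    (Sw : Matrix (Fin n) (Fin n) ℝ) (Sv : Matrix (Fin m) (Fin m) ℝ)
    (Pbar : Matrix (Fin n) (Fin n) ℝ) : Prop :=
  Pbar.PosSemidef ∧ measurementUpdate C Sv (predictCov A Sw Pbar) = Pbar

/-! ### Receptions, holding times and the remote estimation error covariance -/

/-- The holding time `τ(k) = min {0 ≤ t ≤ k : η(k - t) = 1}`; the set is nonempty whenever
`η(0) = 1`, which is the case for all reception sequences below. -/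
noncomputable def holdingTime (η : ℕ → Bool) (k : ℕ) : ℕ :=
  sInf {t : ℕ | t ≤ k ∧ η (k - t) = true}

/-- The error covariance `P(k)` of the remote estimator: it is reset to `Pbar` by a reception and
follows the open-loop prediction otherwise; `P(0) = Pbar`. -/
def errorCov {n : ℕ} (A Sw Pbar : Matrix (Fin n) (Fin n) ℝ) (η : ℕ → Bool) :
    ℕ → Matrix (Fin n) (Fin n) ℝ
  | 0 => Pbar
  | k + 1 => if η (k + 1) = true then Pbar else predictCov A Sw (errorCov A Sw Pbar η k)

/-- A sample path over the horizon `T`: the entry `k` is the pair `(a(k), η(k+1))`. -/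
abbrev Path (T : ℕ) := Fin T → Bool × Bool

/-- The transmission decision `a(k)` along a path. -/
def action {T : ℕ} (ω : Path T) (k : Fin T) : Bool := (ω k).1

/-- The receptions `η(0), …, η(T)` along a path. Here `η(0) = 1` encodes `P(0) = Pbar`, that is
`τ(0) = 0`; values beyond the horizon are irrelevant. -/
def received {T : ℕ} (ω : Path T) : ℕ → Bool
  | 0 => true
  | k + 1 => if h : k < T then (ω ⟨k, h⟩).2 else false

/-! ### Scheduling policies and the law they induce -/

/-- A (history-dependent, possibly randomized) admissible policy: at each time `k` it maps
`τ(0), …, τ(k)` and `a(0), …, a(k-1)` to the probability of the decision `a(k) = 1`. -/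
abbrev Policy := (k : ℕ) → (Fin (k + 1) → ℕ) → (Fin k → Bool) → unitInterval

/-- The probability of `x` for a Bernoulli variable with success probability `p`. -/
def bernoulliProb (p : ℝ) (x : Bool) : ℝ := if x = true then p else 1 - p

/-- The probability of the reception outcome `e` given the decision `a`: a transmission succeeds
with probability `rs`; without a transmission nothing is received. -/
def channelProb (rs : ℝ) (a e : Bool) : ℝ :=
  if a = true then bernoulliProb rs e else bernoulliProb 0 e

/-- The probability that `f` uses at time `k` for transmitting, along the path `ω`. -/
noncomputable def transmitProb (f : Policy) {T : ℕ} (ω : Path T) (k : Fin T) : ℝ :=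
  f k (fun i => holdingTime (received ω) i) (fun i => action ω (i.castLE k.isLt.le))

/-- The probability of the path `ω` under the policy `f`, given `P(0) = Pbar`. -/
noncomputable def pathProb (rs : ℝ) (f : Policy) {T : ℕ} (ω : Path T) : ℝ :=
  ∏ k : Fin T, bernoulliProb (transmitProb f ω k) (action ω k) *
    channelProb rs (action ω k) (received ω ((k : ℕ) + 1))

/-- The expectation, under the policy `f` and given `P(0) = Pbar`, of a function of the path up to
the horizon `T`. -/
noncomputable def expect (rs : ℝ) (f : Policy) (T : ℕ) (X : Path T → ℝ) : ℝ :=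
  ∑ ω : Path T, pathProb rs f ω * X ω

/-! ### Performance criteria and the constrained problem -/

/-- The expected average estimation error
`J_e(f) = limsup_T (1/T) E^f [∑_{k < T} Tr P(k)]`, with values in the extended reals. -/
noncomputable def avgError {n : ℕ} (A Sw Pbar : Matrix (Fin n) (Fin n) ℝ) (rs : ℝ)
    (f : Policy) : EReal :=
  limsup (fun T : ℕ => (((1 / (T : ℝ)) * expect rs f T
    (fun ω => ∑ k : Fin T, (errorCov A Sw Pbar (received ω) k).trace) : ℝ) : EReal)) atTop

/-- The expected average transmission rate `J_r(f) = limsup_T (1/T) E^f [∑_{k < T} a(k)]`. -/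
noncomputable def avgRate (rs : ℝ) (f : Policy) : EReal :=
  limsup (fun T : ℕ => (((1 / (T : ℝ)) * expect rs f T
    (fun ω => ∑ k : Fin T, if action ω k = true then (1 : ℝ) else 0) : ℝ) : EReal)) atTop

/-- `f` solves the constrained communication problem: it satisfies `J_r(f) ≤ b` and minimizes
`J_e` among all admissible policies that do. -/
def SolvesConstrained {n : ℕ} (A Sw Pbar : Matrix (Fin n) (Fin n) ℝ) (rs b : ℝ)
    (f : Policy) : Prop :=
  avgRate rs f ≤ (b : EReal) ∧
    ∀ g : Policy, avgRate rs g ≤ (b : EReal) → avgError A Sw Pbar rs f ≤ avgError A Sw Pbar rs g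

/-- The Bernoulli randomized threshold policy: do not transmit if `τ(k) < θ`, transmit with
probability `r` if `τ(k) = θ`, transmit if `τ(k) > θ`. -/
noncomputable def thresholdPolicy (θ : ℕ) (r : unitInterval) : Policy :=
  fun k τ _ => if τ (Fin.last k) < θ then 0 else if τ (Fin.last k) = θ then r else 1

end RemoteEstimation

namespace RemoteEstimation

/-! ### Holding times -/

/-! The stage cost is `h t`, the trace of the `t`-th open-loop iterate of `Pbar` at holding time
`t`. It is nondecreasing, because a measurement update can only decrease a covariance and `Pbar` is
the update of its own prediction. Nothing else about the plant is used.

The constraint is handled by Lagrangian duality with an explicit certificate. Fix `θ`, put `W t = ∑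
(1 - rs) ^ j * h (t + j)` and `ρ = rs * W (θ + 1)`, and price each transmission at `μ = rs *
excess`, which makes idling and transmitting equally good at `θ`. The function `relativeValue` is
then a subsolution of the average-cost Bellman equation for every decision
(`relativeValue_le_bellman`), with equality along the threshold policy
(`bellman_pricedCost_thresholdProb`). If `b` is the rate of the threshold policy, weak duality
(`le_limsup_average`) bounds the error of every policy of rate at most `b` below by `ρ - μ * b`, and
the threshold policy attains this value.

The lower bound needs a bounded relative value, so it is proved for truncated costs and the
truncation is then removed. If the series `W (θ + 1)` diverges, every competitor has infinite cost.
Finally, the rate of a threshold policy has a closed form that takes every value in `(0, 1]`. -/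

theorem holdingTime_congr {η η' : ℕ → Bool} {k : ℕ} (h : ∀ j ≤ k, η j = η' j) :
    holdingTime η k = holdingTime η' k := by
  unfold holdingTime
  congr 1
  ext t
  simp only [Set.mem_ofPred_eq]
  rw [h (k - t) (Nat.sub_le _ _)]

theorem holdingTime_of_received {η : ℕ → Bool} {k : ℕ} (h : η k = true) :
    holdingTime η k = 0 :=
  Nat.sInf_eq_zero.2 (Or.inl ⟨Nat.zero_le _, h⟩)

theorem holdingTime_succ_of_lost {η : ℕ → Bool} (h0 : η 0 = true) {k : ℕ}
    (h : η (k + 1) = false) : holdingTime η (k + 1) = holdingTime η k + 1 := by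
  -- Nonemptiness rests on `η 0 = true`; the infimum of an empty set would be the default value `0`.
  have hne : {t : ℕ | t ≤ k ∧ η (k - t) = true}.Nonempty := ⟨k, le_rfl, by simpa using h0⟩
  have hmem := Nat.sInf_mem hne
  unfold holdingTime
  refine le_antisymm (Nat.sInf_le ⟨Nat.succ_le_succ hmem.1, ?_⟩) ?_
  · rw [Nat.add_sub_add_right]
    exact hmem.2
  · refine le_csInf ⟨k + 1, le_rfl, by simpa using h0⟩ ?_
    rintro (_ | t) ⟨ht, hη⟩
    · simp [h] at hη
    · rw [Nat.add_sub_add_right] at hη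
      exact Nat.succ_le_succ (Nat.sInf_le ⟨Nat.le_of_succ_le_succ ht, hη⟩)

/-- Reduces the matrix-valued state to the holding time, so that the error becomes a stage cost on
`ℕ`. -/
theorem errorCov_eq_iterate {n : ℕ} (A Sw Pbar : Matrix (Fin n) (Fin n) ℝ) {η : ℕ → Bool}
    (h0 : η 0 = true) (k : ℕ) :
    errorCov A Sw Pbar η k = (predictCov A Sw)^[holdingTime η k] Pbar := by
  induction k with
  | zero => rw [holdingTime_of_received h0]; rfl
  | succ k ih =>
    cases h : η (k + 1)
    · rw [holdingTime_succ_of_lost h0 h, Function.iterate_succ_apply', ← ih]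
      simp [errorCov, h]
    · rw [holdingTime_of_received h]
      simp [errorCov, h]

/-! ### Extending a path by one step -/

/-- The path `ω` followed by one more pair (decision, reception). -/
def extend {T : ℕ} (ω : Path T) (x : Bool × Bool) : Path (T + 1) :=
  Fin.snoc (α := fun _ => Bool × Bool) ω x

@[simp] theorem received_zero {T : ℕ} (ω : Path T) : received ω 0 = true := rfl

theorem received_extend_of_le {T : ℕ} (ω : Path T) (x : Bool × Bool) {j : ℕ} (hj : j ≤ T) :
    received (extend ω x) j = received ω j := by
  cases j with
  | zero => rfl
  | succ k =>
    have hk : k < T := hj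
    have hk' : k < T + 1 := by omega
    simp [received, extend, Fin.snoc, hk, hk']

@[simp] theorem received_extend_last {T : ℕ} (ω : Path T) (x : Bool × Bool) :
    received (extend ω x) (T + 1) = x.2 := by
  simp [received, extend, Fin.snoc]

@[simp] theorem action_extend_castSucc {T : ℕ} (ω : Path T) (x : Bool × Bool) (k : Fin T) :
    action (extend ω x) k.castSucc = action ω k := by
  simp [action, extend]

@[simp] theorem action_extend_last {T : ℕ} (ω : Path T) (x : Bool × Bool) :
    action (extend ω x) (Fin.last T) = x.1 := by
  simp [action, extend]

theorem holdingTime_extend_of_le {T : ℕ} (ω : Path T) (x : Bool × Bool) {j : ℕ} (hj : j ≤ T) :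
    holdingTime (received (extend ω x)) j = holdingTime (received ω) j :=
  holdingTime_congr fun _ hi => received_extend_of_le ω x (hi.trans hj)

theorem holdingTime_extend_last {T : ℕ} (ω : Path T) (x : Bool × Bool) :
    holdingTime (received (extend ω x)) (T + 1) =
      if x.2 = true then 0 else holdingTime (received ω) T + 1 := by
  split_ifs with h
  · exact holdingTime_of_received (by simpa using h)
  · rw [holdingTime_succ_of_lost (by simp) (by simpa using h), holdingTime_extend_of_le ω x le_rfl]

/-- The probability with which `f` transmits in the step after the path `ω`. -/
noncomputable def nextTransmitProb (f : Policy) {T : ℕ} (ω : Path T) : ℝ :=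
  f T (fun i => holdingTime (received ω) i) (action ω)

theorem nextTransmitProb_nonneg (f : Policy) {T : ℕ} (ω : Path T) : 0 ≤ nextTransmitProb f ω :=
  (f T _ _).2.1

theorem nextTransmitProb_le_one (f : Policy) {T : ℕ} (ω : Path T) : nextTransmitProb f ω ≤ 1 :=
  (f T _ _).2.2

theorem transmitProb_extend_castSucc (f : Policy) {T : ℕ} (ω : Path T) (x : Bool × Bool)
    (k : Fin T) : transmitProb f (extend ω x) k.castSucc = transmitProb f ω k := by
  have h1 : (fun i : Fin ((k : ℕ) + 1) => holdingTime (received (extend ω x)) i) =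
      fun i : Fin ((k : ℕ) + 1) => holdingTime (received ω) i := by
    funext i
    exact holdingTime_extend_of_le ω x (by omega)
  have h2 : (fun i : Fin (k : ℕ) =>
      action (extend ω x) (i.castLE k.castSucc.isLt.le)) =
      fun i : Fin (k : ℕ) => action ω (i.castLE k.isLt.le) := by
    funext i
    exact action_extend_castSucc ω x (i.castLE k.isLt.le)
  unfold transmitProb
  exact congrArg Subtype.val (congrArg₂ (f k) h1 h2)

theorem transmitProb_extend_last (f : Policy) {T : ℕ} (ω : Path T) (x : Bool × Bool) :
    transmitProb f (extend ω x) (Fin.last T) = nextTransmitProb f ω := by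
  have h1 : (fun i : Fin (T + 1) => holdingTime (received (extend ω x)) i) =
      fun i : Fin (T + 1) => holdingTime (received ω) i := by
    funext i
    exact holdingTime_extend_of_le ω x (by omega)
  have h2 : (fun i : Fin T => action (extend ω x) (i.castLE (Fin.last T).isLt.le)) =
      action ω := by
    funext i
    exact action_extend_castSucc ω x i
  unfold transmitProb nextTransmitProb
  exact congrArg Subtype.val (congrArg₂ (f T) h1 h2)

theorem pathProb_extend (rs : ℝ) (f : Policy) {T : ℕ} (ω : Path T) (x : Bool × Bool) :
    pathProb rs f (extend ω x) =
      pathProb rs f ω * (bernoulliProb (nextTransmitProb f ω) x.1 * channelProb rs x.1 x.2) := by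
  unfold pathProb
  rw [Fin.prod_univ_castSucc]
  congr 1
  · refine Finset.prod_congr rfl fun k _ => ?_
    rw [transmitProb_extend_castSucc, action_extend_castSucc]
    congr 2
    exact received_extend_of_le ω x k.isLt
  · rw [transmitProb_extend_last, action_extend_last]
    congr 2
    exact received_extend_last ω x

theorem pathProb_nonneg {rs : ℝ} (hrs0 : 0 ≤ rs) (hrs1 : rs ≤ 1) (f : Policy) {T : ℕ}
    (ω : Path T) : 0 ≤ pathProb rs f ω := by
  refine Finset.prod_nonneg fun k _ => mul_nonneg ?_ ?_
  · have h0 : 0 ≤ transmitProb f ω k := (f k _ _).2.1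
    have h1 : transmitProb f ω k ≤ 1 := (f k _ _).2.2
    unfold bernoulliProb
    split_ifs <;> linarith
  · unfold channelProb bernoulliProb
    split_ifs <;> linarith

theorem sum_path_succ {T : ℕ} (F : Path (T + 1) → ℝ) :
    ∑ ω, F ω = ∑ ω : Path T, ∑ x : Bool × Bool, F (extend ω x) := by
  rw [← (Fin.snocEquiv fun _ : Fin (T + 1) => Bool × Bool).sum_comp, Fintype.sum_prod_type_right]
  rfl

/-- Conditioning on the past of the last step. Only three outcomes survive, since a reception
without a transmission has probability zero. -/
theorem expect_succ (rs : ℝ) (f : Policy) (T : ℕ) (X : Path (T + 1) → ℝ) :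
    expect rs f (T + 1) X = expect rs f T fun ω =>
      nextTransmitProb f ω *
        (rs * X (extend ω (true, true)) + (1 - rs) * X (extend ω (true, false))) +
      (1 - nextTransmitProb f ω) * X (extend ω (false, false)) := by
  unfold expect
  rw [sum_path_succ]
  refine Finset.sum_congr rfl fun ω _ => ?_
  simp only [pathProb_extend, Fintype.sum_prod_type, Fintype.sum_bool]
  simp only [bernoulliProb, channelProb]
  simp
  ring

/-! ### Expectations -/

theorem expect_zero (rs : ℝ) (f : Policy) (X : Path 0 → ℝ) : expect rs f 0 X = X ![] := by
  unfold expect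
  rw [Fintype.sum_unique]
  simp [pathProb]
  congr 1

theorem expect_const (rs : ℝ) (f : Policy) (T : ℕ) (c : ℝ) : expect rs f T (fun _ => c) = c := by
  induction T with
  | zero => exact expect_zero ..
  | succ T ih =>
    rw [expect_succ]
    convert ih using 2
    funext ω
    ring

theorem expect_add (rs : ℝ) (f : Policy) (T : ℕ) (X Y : Path T → ℝ) :
    expect rs f T (fun ω => X ω + Y ω) = expect rs f T X + expect rs f T Y := by
  simp [expect, mul_add, Finset.sum_add_distrib]

theorem expect_const_mul (rs : ℝ) (f : Policy) (T : ℕ) (c : ℝ) (X : Path T → ℝ) :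
    expect rs f T (fun ω => c * X ω) = c * expect rs f T X := by
  simp only [expect, Finset.mul_sum]
  exact Finset.sum_congr rfl fun _ _ => by ring

theorem expect_mono {rs : ℝ} (hrs0 : 0 ≤ rs) (hrs1 : rs ≤ 1) (f : Policy) (T : ℕ)
    {X Y : Path T → ℝ} (h : ∀ ω, X ω ≤ Y ω) : expect rs f T X ≤ expect rs f T Y :=
  Finset.sum_le_sum fun ω _ => mul_le_mul_of_nonneg_left (h ω) (pathProb_nonneg hrs0 hrs1 f ω)

/-! ### The Bellman operator of the holding time -/

/-- The total cost along a path when the stage cost depends on holding time and decision. -/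
noncomputable def totalCost (g : ℕ → Bool → ℝ) {T : ℕ} (ω : Path T) : ℝ :=
  ∑ k : Fin T, g (holdingTime (received ω) k) (action ω k)

/-- The expected stage cost plus the expected potential of the next holding time, from the holding
time `t` when transmitting with probability `p`. -/
def bellman (rs : ℝ) (g : ℕ → Bool → ℝ) (V : ℕ → ℝ) (t : ℕ) (p : ℝ) : ℝ :=
  p * (g t true + (rs * V 0 + (1 - rs) * V (t + 1))) + (1 - p) * (g t false + V (t + 1))

theorem totalCost_extend (g : ℕ → Bool → ℝ) {T : ℕ} (ω : Path T) (x : Bool × Bool) :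
    totalCost g (extend ω x) = totalCost g ω + g (holdingTime (received ω) T) x.1 := by
  unfold totalCost
  rw [Fin.sum_univ_castSucc]
  congr 1
  · refine Finset.sum_congr rfl fun k _ => ?_
    rw [action_extend_castSucc]
    congr 1
    exact holdingTime_extend_of_le ω x k.isLt.le
  · rw [action_extend_last]
    congr 1
    exact holdingTime_extend_of_le ω x le_rfl

theorem expect_totalCost_add_potential_succ (rs : ℝ) (f : Policy) (g : ℕ → Bool → ℝ) (V : ℕ → ℝ)
    (T : ℕ) :
    expect rs f (T + 1) (fun ω => totalCost g ω + V (holdingTime (received ω) (T + 1))) =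
      expect rs f T fun ω => totalCost g ω +
        bellman rs g V (holdingTime (received ω) T) (nextTransmitProb f ω) := by
  rw [expect_succ]
  congr 1
  funext ω
  simp only [totalCost_extend, holdingTime_extend_last, bellman]
  simp
  ring

/-- A subsolution of the average-cost Bellman equation bounds the expected total cost from below. -/
theorem le_expect_totalCost {rs : ℝ} (hrs0 : 0 ≤ rs) (hrs1 : rs ≤ 1) (f : Policy)
    (g : ℕ → Bool → ℝ) (V : ℕ → ℝ) (ρ : ℝ)
    (h : ∀ (T : ℕ) (ω : Path T), ρ + V (holdingTime (received ω) T) ≤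
      bellman rs g V (holdingTime (received ω) T) (nextTransmitProb f ω)) (T : ℕ) :
    T * ρ + V 0 ≤ expect rs f T (fun ω => totalCost g ω + V (holdingTime (received ω) T)) := by
  induction T with
  | zero =>
    rw [expect_zero, holdingTime_of_received (received_zero _)]
    simp [totalCost]
  | succ T ih =>
    rw [expect_totalCost_add_potential_succ]
    have h1 : expect rs f T (fun ω => ρ + (totalCost g ω + V (holdingTime (received ω) T))) ≤ _ :=
      expect_mono hrs0 hrs1 f T fun ω => by
        have := h T ω
        show _ ≤ totalCost g ω +
          bellman rs g V (holdingTime (received ω) T) (nextTransmitProb f ω)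
        linarith
    rw [expect_add, expect_const] at h1
    push_cast
    linarith

/-- A supersolution of the average-cost Bellman equation bounds the expected total cost from
above. -/
theorem expect_totalCost_le {rs : ℝ} (hrs0 : 0 ≤ rs) (hrs1 : rs ≤ 1) (f : Policy)
    (g : ℕ → Bool → ℝ) (V : ℕ → ℝ) (ρ : ℝ)
    (h : ∀ (T : ℕ) (ω : Path T),
      bellman rs g V (holdingTime (received ω) T) (nextTransmitProb f ω) ≤
        ρ + V (holdingTime (received ω) T)) (T : ℕ) :
    expect rs f T (fun ω => totalCost g ω + V (holdingTime (received ω) T)) ≤ T * ρ + V 0 := by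
  -- A supersolution becomes a subsolution when cost, potential and `ρ` change sign.
  have key := le_expect_totalCost hrs0 hrs1 f (fun t a => -g t a) (fun t => -V t) (-ρ)
    (fun T ω => by
      have := h T ω
      unfold bellman at this ⊢
      linarith) T
  have h1 : expect rs f T (fun ω => totalCost (fun t a => -g t a) ω +
      -V (holdingTime (received ω) T)) =
      (-1) * expect rs f T (fun ω => totalCost g ω + V (holdingTime (received ω) T)) := by
    rw [← expect_const_mul]
    congr 1
    funext ω
    simp [totalCost]
    ring
  rw [h1] at key
  linarith

/-! ### Upper limits of averages -/

theorem limsup_average_le {e : ℕ → ℝ} {v C : ℝ} (h : ∀ T : ℕ, e T ≤ T * v + C) :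
    limsup (fun T : ℕ => ((1 / (T : ℝ) * e T : ℝ) : EReal)) atTop ≤ v := by
  have hlim : Tendsto (fun T : ℕ => v + C / (T : ℝ)) atTop (nhds v) := by
    simpa using tendsto_const_nhds.add (tendsto_const_div_atTop_nhds_zero_nat C)
  have hlim' : Tendsto (fun T : ℕ => ((v + C / (T : ℝ) : ℝ) : EReal)) atTop (nhds (v : EReal)) :=
    (continuous_coe_real_ereal.tendsto v).comp hlim
  rw [← hlim'.limsup_eq]
  refine limsup_le_limsup ?_
  filter_upwards [eventually_gt_atTop 0] with T hT
  have hT' : (0 : ℝ) < T := Nat.cast_pos.2 hT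
  refine EReal.coe_le_coe_iff.2 ?_
  calc 1 / (T : ℝ) * e T ≤ 1 / (T : ℝ) * (T * v + C) := by gcongr; exact h T
    _ = v + C / T := by field_simp

theorem limsup_average_eq {a : ℕ → ℝ} {b C : ℝ} (h1 : ∀ T : ℕ, T * b - C ≤ a T)
    (h2 : ∀ T : ℕ, a T ≤ T * b + C) :
    limsup (fun T : ℕ => ((1 / (T : ℝ) * a T : ℝ) : EReal)) atTop = b := by
  refine le_antisymm (limsup_average_le h2) ?_
  have hlim : Tendsto (fun T : ℕ => b - C / (T : ℝ)) atTop (nhds b) := by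
    simpa using tendsto_const_nhds.sub (tendsto_const_div_atTop_nhds_zero_nat C)
  have hlim' : Tendsto (fun T : ℕ => ((b - C / (T : ℝ) : ℝ) : EReal)) atTop (nhds (b : EReal)) :=
    (continuous_coe_real_ereal.tendsto b).comp hlim
  rw [← hlim'.limsup_eq]
  refine limsup_le_limsup ?_
  filter_upwards [eventually_gt_atTop 0] with T hT
  have hT' : (0 : ℝ) < T := Nat.cast_pos.2 hT
  refine EReal.coe_le_coe_iff.2 ?_
  calc b - C / T = 1 / (T : ℝ) * (T * b - C) := by field_simp
    _ ≤ 1 / (T : ℝ) * a T := by gcongr; exact h1 T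

/-- Weak Lagrangian duality for averages. -/
theorem le_limsup_average {e a : ℕ → ℝ} {ρ μ b C : ℝ} (hμ : 0 ≤ μ)
    (h : ∀ T : ℕ, T * ρ ≤ e T + μ * a T + C)
    (ha : limsup (fun T : ℕ => ((1 / (T : ℝ) * a T : ℝ) : EReal)) atTop ≤ b) :
    ((ρ - μ * b : ℝ) : EReal) ≤
      limsup (fun T : ℕ => ((1 / (T : ℝ) * e T : ℝ) : EReal)) atTop := by
  refine EReal.ge_of_forall_gt_iff_ge.1 fun z hz => ?_
  rw [EReal.coe_lt_coe_iff] at hz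
  -- The gap below the dual value is split into `μ * ε` for the slack in the rate and `ε` for the
  -- vanishing term `C / T`.
  obtain ⟨ε, hε, hεz⟩ : ∃ ε > 0, z + (μ + 1) * ε = ρ - μ * b :=
    ⟨(ρ - μ * b - z) / (μ + 1), div_pos (by linarith) (by linarith), by field_simp; ring⟩
  have h1 : ∀ᶠ T : ℕ in atTop, ((1 / (T : ℝ) * a T : ℝ) : EReal) < ((b + ε : ℝ) : EReal) :=
    eventually_lt_of_limsup_lt (ha.trans_lt (EReal.coe_lt_coe_iff.2 (by linarith)))
  have h2 : ∀ᶠ T : ℕ in atTop, C / (T : ℝ) < ε :=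
    (tendsto_const_div_atTop_nhds_zero_nat C).eventually_lt_const hε
  refine le_limsup_of_frequently_le (Eventually.frequently ?_)
  filter_upwards [h1, h2, eventually_gt_atTop 0] with T h1 h2 hT
  have hT' : (0 : ℝ) < T := Nat.cast_pos.2 hT
  rw [EReal.coe_lt_coe_iff] at h1
  refine EReal.coe_le_coe_iff.2 ?_
  have h3 : ρ ≤ 1 / (T : ℝ) * e T + μ * (1 / (T : ℝ) * a T) + C / T := by
    calc ρ = 1 / (T : ℝ) * (T * ρ) := by field_simp
      _ ≤ 1 / (T : ℝ) * (e T + μ * a T + C) := by gcongr; exact h T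
      _ = _ := by field_simp
  nlinarith [mul_le_mul_of_nonneg_left h1.le hμ]

/-! ### Threshold policies and their rate -/

/-- The probability of transmitting at holding time `t` under a threshold policy. -/
noncomputable def thresholdProb (θ : ℕ) (r : ℝ) (t : ℕ) : ℝ :=
  if t < θ then 0 else if t = θ then r else 1

theorem nextTransmitProb_thresholdPolicy (θ : ℕ) (r : unitInterval) {T : ℕ} (ω : Path T) :
    nextTransmitProb (thresholdPolicy θ r) ω =
      thresholdProb θ r (holdingTime (received ω) T) := by
  unfold nextTransmitProb thresholdPolicy thresholdProb
  simp only [Fin.val_last]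
  split_ifs <;> rfl

/-- The average transmission rate of a threshold policy. -/
noncomputable def thresholdRate (rs : ℝ) (θ : ℕ) (r : ℝ) : ℝ := 1 / (rs * (θ + 1 - r) + 1)

/-- The stage cost that counts transmissions. -/
def transmissions (_ : ℕ) (a : Bool) : ℝ := if a = true then 1 else 0

theorem avgRate_eq (rs : ℝ) (f : Policy) :
    avgRate rs f = limsup (fun T : ℕ =>
      ((1 / (T : ℝ) * expect rs f T (totalCost transmissions) : ℝ) : EReal)) atTop := rfl

/-- Between receptions there are on average `1 / rs` transmissions and `θ + 1 - r` idle steps,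
whence the rate. The proof uses a bounded exact solution of the Bellman equation, which leaves an
error bounded in `T`. -/
theorem expect_transmissions_threshold {rs : ℝ} (hrs0 : 0 < rs) (hrs1 : rs ≤ 1) (θ : ℕ)
    (r : unitInterval) : ∃ C : ℝ, ∀ T : ℕ,
      T * thresholdRate rs θ r - C ≤
          expect rs (thresholdPolicy θ r) T (totalCost transmissions) ∧
        expect rs (thresholdPolicy θ r) T (totalCost transmissions) ≤
          T * thresholdRate rs θ r + C := by
  obtain ⟨hr0, hr1⟩ := r.2
  have hθ : (0 : ℝ) ≤ θ := Nat.cast_nonneg θ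
  have hD : 1 ≤ rs * (θ + 1 - (r : ℝ)) + 1 := by nlinarith
  set b := thresholdRate rs θ r with hb
  have hbD : b * (rs * (θ + 1 - (r : ℝ)) + 1) = 1 := by
    rw [hb, thresholdRate]
    field_simp
  have hb0 : 0 ≤ b := by rw [hb, thresholdRate]; positivity
  have hb1 : b ≤ 1 := by nlinarith
  -- Idling below `θ` forces slope `b`; beyond `θ` a constant value `u` must satisfy `1 + (1 - rs) *
  -- u = b + u`. The equation at `θ` then fixes `b`.
  let U : ℕ → ℝ := fun t => if t ≤ θ then b * t else (1 - b) / rs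
  have hU0 : U 0 = 0 := by simp [U]
  have hUnn : ∀ t, 0 ≤ U t := fun t => by
    simp only [U]
    split_ifs
    · positivity
    · exact div_nonneg (by linarith) hrs0.le
  have hUle : ∀ t, U t ≤ b * θ + (1 - b) / rs := fun t => by
    have h2 : 0 ≤ (1 - b) / rs := div_nonneg (by linarith) hrs0.le
    simp only [U]
    split_ifs with ht
    · have : (t : ℝ) ≤ θ := Nat.cast_le.2 ht
      nlinarith
    · nlinarith [mul_nonneg hb0 hθ]
  have hBell : ∀ t, bellman rs transmissions U t (thresholdProb θ r t) = b + U t := fun t => by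
    rcases lt_trichotomy t θ with ht | rfl | ht
    · simp [bellman, thresholdProb, transmissions, U, ht, ht.le, Nat.succ_le_of_lt ht]
      ring
    · simp [bellman, thresholdProb, transmissions, U]
      field_simp
      linear_combination -hbD
    · have h1 : ¬ t < θ := by omega
      have h2 : t ≠ θ := by omega
      have h3 : ¬ t ≤ θ := by omega
      have h4 : ¬ t + 1 ≤ θ := by omega
      simp [bellman, thresholdProb, transmissions, U, h1, h2, h3, h4]
      field_simp
      ring
  refine ⟨b * θ + (1 - b) / rs, fun T => ?_⟩
  have hlo := le_expect_totalCost hrs0.le hrs1 (thresholdPolicy θ r) transmissions U b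
    (fun T ω => by rw [nextTransmitProb_thresholdPolicy, hBell]) T
  have hup := expect_totalCost_le hrs0.le hrs1 (thresholdPolicy θ r) transmissions U b
    (fun T ω => by rw [nextTransmitProb_thresholdPolicy, hBell]) T
  rw [expect_add, hU0] at hlo hup
  have h1 := expect_mono hrs0.le hrs1 (thresholdPolicy θ r) T
    (fun ω => hUnn (holdingTime (received ω) T))
  have h2 := expect_mono hrs0.le hrs1 (thresholdPolicy θ r) T
    (fun ω => hUle (holdingTime (received ω) T))
  rw [expect_const] at h1 h2
  constructor <;> linarith

theorem avgRate_thresholdPolicy {rs : ℝ} (hrs0 : 0 < rs) (hrs1 : rs ≤ 1) (θ : ℕ)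
    (r : unitInterval) : avgRate rs (thresholdPolicy θ r) = thresholdRate rs θ r := by
  obtain ⟨C, hC⟩ := expect_transmissions_threshold hrs0 hrs1 θ r
  rw [avgRate_eq]
  exact limsup_average_eq (fun T => (hC T).1) fun T => (hC T).2

theorem exists_thresholdRate_eq {rs b : ℝ} (hrs0 : 0 < rs) (hb0 : 0 < b) (hb1 : b ≤ 1) :
    ∃ (θ : ℕ) (r : unitInterval), thresholdRate rs θ r = b := by
  have hx : 0 ≤ (1 / b - 1) / rs := div_nonneg (by rw [sub_nonneg, le_div_iff₀ hb0]; linarith) hrs0.le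
  -- The rate equals `b` exactly when `θ + 1 - r = (1 / b - 1) / rs`; the floor is the integer part
  -- and `r` makes up the rest.
  refine ⟨⌊(1 / b - 1) / rs⌋₊, ⟨⌊(1 / b - 1) / rs⌋₊ + 1 - (1 / b - 1) / rs, ?_, ?_⟩, ?_⟩
  · linarith [Nat.lt_floor_add_one ((1 / b - 1) / rs)]
  · linarith [Nat.floor_le hx]
  · unfold thresholdRate
    simp only [sub_sub_cancel]
    field_simp
    ring

/-! ### The relative value function of a threshold policy -/

section RelativeValue

variable (c W : ℕ → ℝ) (rs : ℝ) (θ : ℕ)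

/-- The sum over the holding times up to `θ` of the excess of `rs * W (θ + 1)` over the cost. -/
def excess : ℝ := ∑ s ∈ Finset.range (θ + 1), (rs * W (θ + 1) - c s)

/-- The relative value function of the Lagrangian cost `c t + rs * excess * a` for which both
decisions are optimal at holding time `θ`. -/
def relativeValue (t : ℕ) : ℝ :=
  ∑ s ∈ Finset.range (min t (θ + 1)), (rs * W (θ + 1) - c s) + (W (max t (θ + 1)) - W (θ + 1))

/-- The stage cost `c` plus a price for each transmission. -/
def pricedCost (t : ℕ) (a : Bool) : ℝ := c t + rs * excess c W rs θ * transmissions t a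

variable {c W rs θ}

theorem relativeValue_zero : relativeValue c W rs θ 0 = 0 := by
  simp [relativeValue]

theorem relativeValue_succ_of_le {t : ℕ} (ht : t ≤ θ) :
    relativeValue c W rs θ (t + 1) = relativeValue c W rs θ t + (rs * W (θ + 1) - c t) := by
  have h1 : min (t + 1) (θ + 1) = t + 1 := by omega
  have h2 : min t (θ + 1) = t := by omega
  have h3 : max (t + 1) (θ + 1) = θ + 1 := by omega
  have h4 : max t (θ + 1) = θ + 1 := by omega
  simp only [relativeValue, h1, h2, h3, h4, Finset.sum_range_succ]
  ring

theorem relativeValue_of_gt {t : ℕ} (ht : θ < t) :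
    relativeValue c W rs θ t = excess c W rs θ + (W t - W (θ + 1)) := by
  have h1 : min t (θ + 1) = θ + 1 := by omega
  have h2 : max t (θ + 1) = t := by omega
  simp only [relativeValue, excess, h1, h2]

theorem relativeValue_idle {t : ℕ} (ht : t ≤ θ) :
    c t + relativeValue c W rs θ (t + 1) = rs * W (θ + 1) + relativeValue c W rs θ t := by
  rw [relativeValue_succ_of_le ht]
  ring

/-- At `θ` this is the choice of the price: with `μ = rs * V (θ + 1)`, where `V` is the relative
value, transmitting costs as much as idling. Beyond `θ` it is the recursion for `W`, shifted by a
constant. -/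
theorem relativeValue_transmit (hW : ∀ t, θ < t → W t = c t + (1 - rs) * W (t + 1)) {t : ℕ}
    (ht : θ ≤ t) :
    c t + rs * excess c W rs θ + (1 - rs) * relativeValue c W rs θ (t + 1) =
      rs * W (θ + 1) + relativeValue c W rs θ t := by
  rcases ht.eq_or_lt with rfl | ht
  · have h := relativeValue_idle (c := c) (W := W) (rs := rs) (le_refl θ)
    rw [relativeValue_of_gt (Nat.lt_succ_self θ)] at h ⊢
    linarith
  · rw [relativeValue_of_gt ht, relativeValue_of_gt (Nat.lt_succ_of_lt ht)]
    linarith [hW t ht]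

theorem bellman_pricedCost (t : ℕ) (p : ℝ) :
    bellman rs (pricedCost c W rs θ) (relativeValue c W rs θ) t p =
      p * (c t + rs * excess c W rs θ + (1 - rs) * relativeValue c W rs θ (t + 1)) +
        (1 - p) * (c t + relativeValue c W rs θ (t + 1)) := by
  simp only [bellman, relativeValue_zero, pricedCost, transmissions]
  simp

/-- At `θ` both decisions attain the Bellman value, so the randomization `r` is arbitrary. -/
theorem bellman_pricedCost_thresholdProb
    (hW : ∀ t, θ < t → W t = c t + (1 - rs) * W (t + 1)) (r : ℝ) (t : ℕ) :
    bellman rs (pricedCost c W rs θ) (relativeValue c W rs θ) t (thresholdProb θ r t) =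
      rs * W (θ + 1) + relativeValue c W rs θ t := by
  rw [bellman_pricedCost]
  rcases lt_trichotomy t θ with ht | rfl | ht
  · rw [relativeValue_idle ht.le]
    simp [thresholdProb, ht]
  · rw [relativeValue_idle le_rfl, relativeValue_transmit hW le_rfl]
    ring
  · rw [relativeValue_transmit hW ht.le]
    have h1 : ¬ t < θ := by omega
    have h2 : t ≠ θ := by omega
    simp [thresholdProb, h1, h2]

theorem monotone_relativeValue (hc : ∀ t ≤ θ, c t ≤ rs * W (θ + 1))
    (hWm : ∀ t, θ < t → W t ≤ W (t + 1)) : Monotone (relativeValue c W rs θ) := by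
  refine monotone_nat_of_le_succ fun t => ?_
  rcases le_or_gt t θ with ht | ht
  · rw [relativeValue_succ_of_le ht]
    linarith [hc t ht]
  · rw [relativeValue_of_gt ht, relativeValue_of_gt (Nat.lt_succ_of_lt ht)]
    linarith [hWm t ht]

/-- Idling costs `rs * (V (t + 1) - V (θ + 1))` more than transmitting, `V` being the relative
value. Monotonicity of `V` makes this nonpositive below `θ` and nonnegative above, and the better
decision is already tight. -/
theorem relativeValue_le_bellman (hrs0 : 0 < rs)
    (hc : ∀ t ≤ θ, c t ≤ rs * W (θ + 1))
    (hW : ∀ t, θ < t → W t = c t + (1 - rs) * W (t + 1))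
    (hWm : ∀ t, θ < t → W t ≤ W (t + 1)) (t : ℕ) {p : ℝ} (hp0 : 0 ≤ p) (hp1 : p ≤ 1) :
    rs * W (θ + 1) + relativeValue c W rs θ t ≤
      bellman rs (pricedCost c W rs θ) (relativeValue c W rs θ) t p := by
  have hmono := monotone_relativeValue hc hWm
  have hθ : relativeValue c W rs θ (θ + 1) = excess c W rs θ := by
    rw [relativeValue_of_gt (Nat.lt_succ_self θ)]
    ring
  have hidle : rs * W (θ + 1) + relativeValue c W rs θ t ≤
      c t + relativeValue c W rs θ (t + 1) := by
    rcases le_or_gt t θ with ht | ht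
    · exact (relativeValue_idle ht).ge
    · have h1 := relativeValue_transmit hW ht.le
      have h2 : excess c W rs θ ≤ relativeValue c W rs θ (t + 1) := by
        rw [← hθ]
        exact hmono (by omega)
      linarith [mul_le_mul_of_nonneg_left h2 hrs0.le]
  have htrans : rs * W (θ + 1) + relativeValue c W rs θ t ≤
      c t + rs * excess c W rs θ + (1 - rs) * relativeValue c W rs θ (t + 1) := by
    rcases le_or_gt θ t with ht | ht
    · exact (relativeValue_transmit hW ht).ge
    · have h1 := relativeValue_idle (c := c) (W := W) (rs := rs) ht.le
      have h2 : relativeValue c W rs θ (t + 1) ≤ excess c W rs θ := by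
        rw [← hθ]
        exact hmono (by omega)
      linarith [mul_le_mul_of_nonneg_left h2 hrs0.le]
  rw [bellman_pricedCost]
  linarith [mul_le_mul_of_nonneg_left htrans hp0,
    mul_le_mul_of_nonneg_left hidle (sub_nonneg.2 hp1)]

theorem expect_pricedCost (f : Policy) (T : ℕ) :
    expect rs f T (totalCost (pricedCost c W rs θ)) =
      expect rs f T (totalCost fun t _ => c t) +
        rs * excess c W rs θ * expect rs f T (totalCost transmissions) := by
  rw [← expect_const_mul, ← expect_add]
  congr 1
  funext ω
  simp only [totalCost, pricedCost, Finset.sum_add_distrib, Finset.mul_sum]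

theorem excess_nonneg (hc : ∀ t ≤ θ, c t ≤ rs * W (θ + 1)) : 0 ≤ excess c W rs θ :=
  Finset.sum_nonneg fun s hs =>
    sub_nonneg.2 (hc s (Nat.lt_succ_iff.1 (Finset.mem_range.1 hs)))

variable (rs θ) in
/-- The average cost of a threshold policy, in terms of the costs at the holding times up to `θ`
and the discounted cost `w` of the later ones. -/
noncomputable def thresholdCost (r : ℝ) (c : ℕ → ℝ) (w : ℝ) : ℝ :=
  thresholdRate rs θ r * rs * (∑ s ∈ Finset.range (θ + 1), c s + (1 - r * rs) * w)

/-- The right side is the renewal-reward form: `thresholdRate * rs` is the reciprocal mean cycle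
length, and a cycle passes beyond `θ` with probability `1 - r * rs`. -/
theorem lagrangian_eq_thresholdCost (hrs0 : 0 < rs) {r : ℝ} (hr1 : r ≤ 1) :
    rs * W (θ + 1) - rs * excess c W rs θ * thresholdRate rs θ r =
      thresholdCost rs θ r c (W (θ + 1)) := by
  have hθ : (0 : ℝ) ≤ θ := Nat.cast_nonneg θ
  have hD : 0 < rs * (θ + 1 - r) + 1 := by nlinarith
  have hbD : thresholdRate rs θ r * (rs * (θ + 1 - r) + 1) = 1 := by
    rw [thresholdRate]
    field_simp
  simp only [thresholdCost, excess, Finset.sum_sub_distrib, Finset.sum_const, Finset.card_range,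
    nsmul_eq_mul]
  push_cast
  linear_combination (-(rs * W (θ + 1))) * hbD

/-- Lower bound for the average of a bounded cost over all policies that respect the rate. -/
theorem thresholdCost_le_limsup (hrs0 : 0 < rs) (hrs1 : rs ≤ 1)
    (hc : ∀ t ≤ θ, c t ≤ rs * W (θ + 1))
    (hW : ∀ t, θ < t → W t = c t + (1 - rs) * W (t + 1))
    (hWm : ∀ t, θ < t → W t ≤ W (t + 1)) {B : ℝ} (hB : ∀ t, W t ≤ B) {r : ℝ} (hr1 : r ≤ 1)
    (f : Policy) (hf : avgRate rs f ≤ (thresholdRate rs θ r : EReal)) :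
    (thresholdCost rs θ r c (W (θ + 1)) : EReal) ≤ limsup (fun T : ℕ =>
      ((1 / (T : ℝ) * expect rs f T (totalCost fun t _ => c t) : ℝ) : EReal)) atTop := by
  rw [avgRate_eq] at hf
  rw [← lagrangian_eq_thresholdCost hrs0 hr1]
  refine le_limsup_average (C := excess c W rs θ + (B - W (θ + 1)))
    (mul_nonneg hrs0.le (excess_nonneg hc)) (fun T => ?_) hf
  have h := le_expect_totalCost hrs0.le hrs1 f (pricedCost c W rs θ) (relativeValue c W rs θ)
    (rs * W (θ + 1)) (fun T ω => relativeValue_le_bellman hrs0 hc hW hWm _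
      (nextTransmitProb_nonneg f ω) (nextTransmitProb_le_one f ω)) T
  rw [expect_add, expect_pricedCost, relativeValue_zero] at h
  -- Here the boundedness of `W` is essential: the terminal relative value must be negligible after
  -- division by `T`.
  have hV : ∀ t, relativeValue c W rs θ t ≤ excess c W rs θ + (B - W (θ + 1)) := fun t => by
    refine (monotone_relativeValue hc hWm (le_max_left t (θ + 1))).trans ?_
    rw [relativeValue_of_gt (by omega)]
    linarith [hB (max t (θ + 1))]
  have h1 := expect_mono hrs0.le hrs1 f T (fun ω => hV (holdingTime (received ω) T))
  rw [expect_const] at h1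
  linarith

/-- Upper bound for the average cost of a threshold policy. -/
theorem limsup_le_thresholdCost (hrs0 : 0 < rs) (hrs1 : rs ≤ 1)
    (hc : ∀ t ≤ θ, c t ≤ rs * W (θ + 1))
    (hW : ∀ t, θ < t → W t = c t + (1 - rs) * W (t + 1))
    (hWm : ∀ t, θ < t → W t ≤ W (t + 1)) (r : unitInterval) :
    limsup (fun T : ℕ => ((1 / (T : ℝ) *
      expect rs (thresholdPolicy θ r) T (totalCost fun t _ => c t) : ℝ) : EReal)) atTop ≤
      (thresholdCost rs θ r c (W (θ + 1)) : EReal) := by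
  obtain ⟨C, hC⟩ := expect_transmissions_threshold hrs0 hrs1 θ r
  rw [← lagrangian_eq_thresholdCost hrs0 r.2.2]
  refine limsup_average_le (C := rs * excess c W rs θ * C) fun T => ?_
  have h := expect_totalCost_le hrs0.le hrs1 (thresholdPolicy θ r) (pricedCost c W rs θ)
    (relativeValue c W rs θ) (rs * W (θ + 1)) (fun T ω => by
      rw [nextTransmitProb_thresholdPolicy, bellman_pricedCost_thresholdProb hW]) T
  rw [expect_add, expect_pricedCost, relativeValue_zero] at h
  -- In this direction the terminal value need only be nonnegative, so `W` may be unbounded.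
  have hV : ∀ t, 0 ≤ relativeValue c W rs θ t := fun t => by
    rw [← relativeValue_zero (c := c) (W := W) (rs := rs) (θ := θ)]
    exact monotone_relativeValue hc hWm (Nat.zero_le t)
  have h1 := expect_mono hrs0.le hrs1 (thresholdPolicy θ r) T
    (fun ω => hV (holdingTime (received ω) T))
  rw [expect_const] at h1
  linarith [mul_le_mul_of_nonneg_left (hC T).1 (mul_nonneg hrs0.le (excess_nonneg hc))]

end RelativeValue

/-! ### Discounted costs -/

/-- The cost `∑ q ^ j * c (t + j)` accumulated from holding time `t` when each further step occurs
with probability `q`. -/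
noncomputable def discountedCost (q : ℝ) (c : ℕ → ℝ) (t : ℕ) : ℝ := ∑' j, q ^ j * c (t + j)

section DiscountedCost

variable {q : ℝ} {c : ℕ → ℝ}

theorem summable_discounted_of_le {t u : ℕ} (h : Summable fun j => q ^ j * c (t + j))
    (htu : t ≤ u) : Summable fun j => q ^ j * c (u + j) := by
  induction u, htu using Nat.le_induction with
  | base => exact h
  | succ u _ ih =>
    rcases eq_or_ne q 0 with rfl | hq
    · refine summable_of_ne_finset_zero (s := {0}) fun j hj => ?_
      simp only [Finset.mem_singleton] at hj
      simp [hj]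
    · have h1 := ((summable_nat_add_iff 1).2 ih).mul_left q⁻¹
      refine h1.congr fun j => ?_
      rw [pow_succ, add_right_comm, add_assoc u j 1]
      field_simp

theorem discountedCost_eq {t : ℕ} (h : Summable fun j => q ^ j * c (t + j)) :
    discountedCost q c t = c t + q * discountedCost q c (t + 1) := by
  unfold discountedCost
  rw [h.tsum_eq_zero_add, ← tsum_mul_left]
  congr 1
  · simp
  · refine tsum_congr fun j => ?_
    rw [pow_succ, add_right_comm, add_assoc t j 1]
    ring

theorem discountedCost_mono (hq : 0 ≤ q) (hc : Monotone c) {t u : ℕ} (htu : t ≤ u)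
    (h : Summable fun j => q ^ j * c (t + j)) : discountedCost q c t ≤ discountedCost q c u :=
  h.tsum_le_tsum (fun j => mul_le_mul_of_nonneg_left (hc (by omega)) (pow_nonneg hq j))
    (summable_discounted_of_le h htu)

/-- All terms of the series are at least `c t`, and the weights `q ^ j` sum to `1 / (1 - q)`; the
recursion gives this without summing. -/
theorem le_discountedCost (hq : 0 ≤ q) (hc : Monotone c) {t u : ℕ} (htu : t ≤ u)
    (h : Summable fun j => q ^ j * c (u + j)) : c t ≤ (1 - q) * discountedCost q c u := by
  have h1 := discountedCost_eq h
  have h2 := discountedCost_mono hq hc (Nat.le_succ u) h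
  have h3 := hc htu
  nlinarith [mul_le_mul_of_nonneg_left h2 hq]

theorem summable_discounted_of_bounded (hq : 0 ≤ q) (hq1 : q < 1) (h0 : ∀ t, 0 ≤ c t) {B : ℝ}
    (hB : ∀ t, c t ≤ B) (t : ℕ) : Summable fun j => q ^ j * c (t + j) :=
  ((summable_geometric_of_lt_one hq hq1).mul_right B).of_nonneg_of_le
    (fun j => mul_nonneg (pow_nonneg hq j) (h0 _))
    fun j => mul_le_mul_of_nonneg_left (hB _) (pow_nonneg hq j)

end DiscountedCost

/-! ### Optimality of threshold policies for monotone costs of the holding time -/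

section Threshold

variable {h : ℕ → ℝ} {rs : ℝ}

theorem thresholdCost_partial_le_limsup (hrs0 : 0 < rs) (hrs1 : rs ≤ 1) (hh : Monotone h)
    (h0 : ∀ t, 0 ≤ h t) (θ : ℕ) (r : unitInterval) (f : Policy)
    (hf : avgRate rs f ≤ (thresholdRate rs θ r : EReal)) (K : ℕ) :
    (thresholdCost rs θ r h (∑ j ∈ Finset.range K, (1 - rs) ^ j * h (θ + 1 + j)) : EReal) ≤
      limsup (fun T : ℕ =>
        ((1 / (T : ℝ) * expect rs f T (totalCost fun t _ => h t) : ℝ) : EReal)) atTop := by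
  have hq0 : 0 ≤ 1 - rs := by linarith
  have hq1 : 1 - rs < 1 := by linarith
  obtain ⟨hr0, hr1⟩ := r.2
  have hrate : 0 ≤ thresholdRate rs θ r := by
    have hθ : (0 : ℝ) ≤ θ := Nat.cast_nonneg θ
    have : 0 ≤ θ + 1 - (r : ℝ) := by linarith
    unfold thresholdRate
    positivity
  -- Truncation at `N` makes the cost bounded while keeping it equal to `h` on all holding times
  -- entering the first `K` terms of the series.
  set N := θ + 1 + K with hN
  let c : ℕ → ℝ := fun t => h (min t N)
  have hcm : Monotone c := fun s t hst => hh (by omega)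
  have hc0 : ∀ t, 0 ≤ c t := fun t => h0 _
  have hcN : ∀ t, c t ≤ h N := fun t => hh (by omega)
  have hch : ∀ t, c t ≤ h t := fun t => hh (by omega)
  have hceq : ∀ t ≤ N, c t = h t := fun t ht => by simp only [c, min_eq_left ht]
  have hs := summable_discounted_of_bounded hq0 hq1 hc0 hcN
  have hbound : ∀ t, discountedCost (1 - rs) c t ≤ discountedCost (1 - rs) c N := fun t => by
    refine (hs t).tsum_le_tsum (fun j => mul_le_mul_of_nonneg_left ?_ (pow_nonneg hq0 j)) (hs N)
    exact (hcN _).trans_eq (by simp [c])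
  have key := thresholdCost_le_limsup (c := c) (W := discountedCost (1 - rs) c) (θ := θ)
    hrs0 hrs1
    (fun t ht => by
      have := le_discountedCost hq0 hcm (Nat.le_succ_of_le ht) (hs (θ + 1))
      rwa [sub_sub_cancel] at this)
    (fun t _ => discountedCost_eq (hs t))
    (fun t _ => discountedCost_mono hq0 hcm (Nat.le_succ t) (hs t)) hbound hr1 f hf
  refine le_trans (EReal.coe_le_coe_iff.2 ?_) (key.trans (limsup_le_limsup ?_))
  · have h1 : ∑ s ∈ Finset.range (θ + 1), h s = ∑ s ∈ Finset.range (θ + 1), c s :=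
      Finset.sum_congr rfl fun s hs => (hceq s (by have := Finset.mem_range.1 hs; omega)).symm
    have h2 : ∑ j ∈ Finset.range K, (1 - rs) ^ j * h (θ + 1 + j) ≤
        discountedCost (1 - rs) c (θ + 1) := by
      refine le_trans (le_of_eq (Finset.sum_congr rfl fun j hj => ?_))
        ((hs (θ + 1)).sum_le_tsum (Finset.range K)
          fun j _ => mul_nonneg (pow_nonneg hq0 j) (hc0 _))
      rw [hceq _ (by have := Finset.mem_range.1 hj; omega)]
    unfold thresholdCost
    rw [h1]
    have h3 : 0 ≤ 1 - (r : ℝ) * rs := by nlinarith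
    gcongr
  · refine Eventually.of_forall fun T => EReal.coe_le_coe_iff.2 ?_
    refine mul_le_mul_of_nonneg_left (expect_mono hrs0.le hrs1 f T fun ω => ?_) (by positivity)
    exact Finset.sum_le_sum fun k _ => hch _

/-- For a nondecreasing cost of the holding time, threshold policies are optimal among all policies
with at most their rate. -/
theorem limsup_thresholdPolicy_le (hrs0 : 0 < rs) (hrs1 : rs ≤ 1) (hh : Monotone h)
    (h0 : ∀ t, 0 ≤ h t) (θ : ℕ) (r : unitInterval) (f : Policy)
    (hf : avgRate rs f ≤ (thresholdRate rs θ r : EReal)) :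
    limsup (fun T : ℕ => ((1 / (T : ℝ) *
      expect rs (thresholdPolicy θ r) T (totalCost fun t _ => h t) : ℝ) : EReal)) atTop ≤
      limsup (fun T : ℕ =>
        ((1 / (T : ℝ) * expect rs f T (totalCost fun t _ => h t) : ℝ) : EReal)) atTop := by
  have hq0 : 0 ≤ 1 - rs := by linarith
  obtain ⟨hr0, hr1⟩ := r.2
  have key := thresholdCost_partial_le_limsup hrs0 hrs1 hh h0 θ r f hf
  by_cases hs : Summable fun j => (1 - rs) ^ j * h (θ + 1 + j)
  · have hs' : ∀ t, θ < t → Summable fun j => (1 - rs) ^ j * h (t + j) :=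
      fun t ht => summable_discounted_of_le hs ht
    refine (limsup_le_thresholdCost (c := h) (W := discountedCost (1 - rs) h) hrs0 hrs1
      (fun t ht => by
        have := le_discountedCost hq0 hh (Nat.le_succ_of_le ht) hs
        rwa [sub_sub_cancel] at this)
      (fun t ht => discountedCost_eq (hs' t ht))
      (fun t ht => discountedCost_mono hq0 hh (Nat.le_succ t) (hs' t ht)) r).trans ?_
    have hlim : Tendsto (fun K => thresholdCost rs θ r h
        (∑ j ∈ Finset.range K, (1 - rs) ^ j * h (θ + 1 + j))) atTop
        (nhds (thresholdCost rs θ r h (discountedCost (1 - rs) h (θ + 1)))) :=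
      ((hs.hasSum.tendsto_sum_nat.const_mul _).const_add _).const_mul _
    exact le_of_tendsto' ((continuous_coe_real_ereal.tendsto _).comp hlim) key
  · have hlim := (not_summable_iff_tendsto_nat_atTop_of_nonneg
      fun j => mul_nonneg (pow_nonneg hq0 j) (h0 (θ + 1 + j))).1 hs
    -- For `rs = 1` the series has a single nonzero term at most. Divergence thus gives `rs < 1`, so
    -- the weight `1 - r * rs` of the tail is positive.
    have hrs : rs < 1 := by
      refine lt_of_le_of_ne hrs1 fun h1 => hs ?_
      refine summable_of_ne_finset_zero (s := {0}) fun j hj => ?_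
      simp only [Finset.mem_singleton] at hj
      simp [h1, hj]
    have h3 : 0 < 1 - (r : ℝ) * rs := by nlinarith
    have hrate : 0 < thresholdRate rs θ r * rs := by
      have hθ : (0 : ℝ) ≤ θ := Nat.cast_nonneg θ
      have : 0 ≤ θ + 1 - (r : ℝ) := by linarith
      unfold thresholdRate
      positivity
    have hlim' : Tendsto (fun K => thresholdCost rs θ r h
        (∑ j ∈ Finset.range K, (1 - rs) ^ j * h (θ + 1 + j))) atTop atTop :=
      (tendsto_atTop_add_const_left _ _ (hlim.const_mul_atTop h3)).const_mul_atTop hrate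
    refine le_top.trans_eq ((EReal.eq_top_iff_forall_lt _).2 fun y => ?_).symm
    obtain ⟨K, hK⟩ := (hlim'.eventually_gt_atTop y).exists
    exact (EReal.coe_lt_coe_iff.2 hK).trans_le (key K)

end Threshold

/-! ### Monotonicity of the open-loop error covariance -/

section Covariance

variable {n m : ℕ} {A : Matrix (Fin n) (Fin n) ℝ} {C : Matrix (Fin m) (Fin n) ℝ}
  {Sw : Matrix (Fin n) (Fin n) ℝ} {Sv : Matrix (Fin m) (Fin m) ℝ}
  {Pbar : Matrix (Fin n) (Fin n) ℝ}

theorem posSemidef_mul_mul_transpose {k l : ℕ} {P : Matrix (Fin k) (Fin k) ℝ} (hP : P.PosSemidef)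
    (B : Matrix (Fin l) (Fin k) ℝ) : (B * P * Bᵀ).PosSemidef := by
  simpa only [conjTranspose_eq_transpose_of_trivial] using hP.mul_mul_conjTranspose_same B

theorem posSemidef_predictCov (hSw : Sw.PosSemidef) {P : Matrix (Fin n) (Fin n) ℝ}
    (hP : P.PosSemidef) : (predictCov A Sw P).PosSemidef :=
  (posSemidef_mul_mul_transpose hP A).add hSw

/-- The reduction is a congruence transform, by `M * Cᵀ`, of the inverse innovation covariance. -/
theorem posSemidef_sub_measurementUpdate (hSv : Sv.PosDef) {M : Matrix (Fin n) (Fin n) ℝ}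
    (hM : M.PosSemidef) : (M - measurementUpdate C Sv M).PosSemidef := by
  have hMt : Mᵀ = M := by
    simpa only [IsHermitian, conjTranspose_eq_transpose_of_trivial] using hM.isHermitian
  have h1 : (C * M * Cᵀ + Sv)⁻¹.PosSemidef :=
    ((posSemidef_mul_mul_transpose hM C).add hSv.posSemidef).inv
  have h2 := posSemidef_mul_mul_transpose h1 (M * Cᵀ)
  rw [transpose_mul, transpose_transpose, hMt] at h2
  simpa only [measurementUpdate, sub_sub_cancel, Matrix.mul_assoc] using h2

theorem posSemidef_iterate_predictCov (hSw : Sw.PosSemidef) (hP : Pbar.PosSemidef) (t : ℕ) :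
    ((predictCov A Sw)^[t] Pbar).PosSemidef := by
  induction t with
  | zero => exact hP
  | succ t ih =>
    rw [Function.iterate_succ_apply']
    exact posSemidef_predictCov hSw ih

/-- The noise covariance cancels in differences of predictions, leaving a congruence by `A`. -/
theorem posSemidef_iterate_predictCov_succ_sub
    (h : (predictCov A Sw Pbar - Pbar).PosSemidef) (t : ℕ) :
    ((predictCov A Sw)^[t + 1] Pbar - (predictCov A Sw)^[t] Pbar).PosSemidef := by
  induction t with
  | zero => exact h
  | succ t ih =>
    rw [Function.iterate_succ_apply' _ (t + 1), Function.iterate_succ_apply' _ t]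
    rw [Function.iterate_succ_apply' _ t] at ih
    have h1 := posSemidef_mul_mul_transpose ih A
    rw [Matrix.mul_sub, Matrix.sub_mul] at h1
    simpa only [predictCov, add_sub_add_right_eq_sub] using h1

theorem monotone_trace_iterate_predictCov (hSw : Sw.PosSemidef) (hSv : Sv.PosDef)
    (hPbar : IsKalmanSteadyState A C Sw Sv Pbar) :
    Monotone fun t => ((predictCov A Sw)^[t] Pbar).trace := by
  have h : (predictCov A Sw Pbar - Pbar).PosSemidef := by
    have := posSemidef_sub_measurementUpdate (C := C) hSv
      (posSemidef_predictCov (A := A) hSw hPbar.1)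
    rwa [hPbar.2] at this
  refine monotone_nat_of_le_succ fun t => ?_
  have := (posSemidef_iterate_predictCov_succ_sub h t).trace_nonneg
  rwa [trace_sub, sub_nonneg] at this

theorem avgError_eq (rs : ℝ) (f : Policy) :
    avgError A Sw Pbar rs f = limsup (fun T : ℕ => ((1 / (T : ℝ) * expect rs f T
      (totalCost fun t _ => ((predictCov A Sw)^[t] Pbar).trace) : ℝ) : EReal)) atTop := by
  unfold avgError totalCost
  simp only [errorCov_eq_iterate A Sw Pbar (received_zero _)]

end Covariance

/-- A threshold policy is optimal among all policies with at most its transmission rate. -/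
theorem solvesConstrained_thresholdPolicy {n m : ℕ} {A : Matrix (Fin n) (Fin n) ℝ}
    {C : Matrix (Fin m) (Fin n) ℝ} {Sw : Matrix (Fin n) (Fin n) ℝ} {Sv : Matrix (Fin m) (Fin m) ℝ}
    (hSw : Sw.PosSemidef) (hSv : Sv.PosDef) {Pbar : Matrix (Fin n) (Fin n) ℝ}
    (hPbar : IsKalmanSteadyState A C Sw Sv Pbar) {rs : ℝ} (hrs0 : 0 < rs) (hrs1 : rs ≤ 1) {b : ℝ}
    (θ : ℕ) (r : unitInterval) (hb : avgRate rs (thresholdPolicy θ r) = (b : EReal)) :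
    SolvesConstrained A Sw Pbar rs b (thresholdPolicy θ r) := by
  refine ⟨hb.le, fun g hg => ?_⟩
  rw [avgError_eq, avgError_eq]
  rw [← hb, avgRate_thresholdPolicy hrs0 hrs1] at hg
  exact limsup_thresholdPolicy_le hrs0 hrs1 (monotone_trace_iterate_predictCov hSw hSv hPbar)
    (fun t => (posSemidef_iterate_predictCov hSw hPbar.1 t).trace_nonneg) θ r g hg

end RemoteEstimation

open RemoteEstimation in
theorem theorem2 {n m : ℕ}
    (A : Matrix (Fin n) (Fin n) ℝ) (C : Matrix (Fin m) (Fin n) ℝ)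
    (Sw : Matrix (Fin n) (Fin n) ℝ) (Sv : Matrix (Fin m) (Fin m) ℝ)
    (hSw : Sw.PosSemidef) (hSv : Sv.PosDef)
    (hdet : Detectable A C) (hstab : Stabilizable A (CFC.sqrt Sw))
    (Pbar : Matrix (Fin n) (Fin n) ℝ) (hPbar : IsKalmanSteadyState A C Sw Sv Pbar)
    (rs : ℝ) (hrs0 : 0 < rs) (hrs1 : rs ≤ 1)
    (b : ℝ) (hb0 : 0 < b) (hb1 : b ≤ 1) :
    (∃ (θ : ℕ) (r : unitInterval),
      avgRate rs (thresholdPolicy θ r) = (b : EReal) ∧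
        SolvesConstrained A Sw Pbar rs b (thresholdPolicy θ r)) ∧
    (∀ (θ : ℕ) (r : unitInterval),
      avgRate rs (thresholdPolicy θ r) = (b : EReal) →
        SolvesConstrained A Sw Pbar rs b (thresholdPolicy θ r)) := by
  refine ⟨?_, fun θ r hb => solvesConstrained_thresholdPolicy hSw hSv hPbar hrs0 hrs1 θ r hb⟩
  obtain ⟨θ, r, hr⟩ := exists_thresholdRate_eq hrs0 hb0 hb1
  have hb : avgRate rs (thresholdPolicy θ r) = (b : EReal) := by
    rw [avgRate_thresholdPolicy hrs0 hrs1, hr]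
  exact ⟨θ, r, hb, solvesConstrained_thresholdPolicy hSw hSv hPbar hrs0 hrs1 θ r hb⟩
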